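/- Let $p$ be a prime, $k\ge 1$, $q=p^k$, and let $R$ be a commutative Noetherian ring of characteristic $p$. Write $F:R\to R$, $r\mapsto r^q$, for the Frobenius, and $F^e_*R$ for $R$ regarded as an $R$-module through $F^e$. Assume that $R$ is $F$-finite, i.e. $F$ is a finite ring homomorphism. $R$ is called $F$-split if for some $e\ge 1$ there is a splitting of $F^e$, i.e. an additive map $C:R\to R$ with $C(r^{q^e}s)=r\,C(s)$ and $C(r^{q^e})=r$ for all $r,s\in R$. A Cartier submodule of $(R,C)$ is an ideal $I$ with $C(I)\subseteq I$. A left $R[F]$-module is an $R$-module $M$ with an additive map $\varphi:M\to M$ satisfying $\varphi(rm)=r^q\varphi(m)$; an $R[F]$-submodule is an $R$-submodule $N$ with $\varphi(N)\subseteq N$; and $M$ is anti-nilpotent if it has no nonzero nilpotent subquotient, i.e. if $N\subseteq N'$ are $R[F]$-submodules with $\varphi^n(N')\subseteq N$ for some $n\ge 0$, then $N=N'$. 1. For every $e\ge 1$ and every splitting $C:F^e_*R\to R$ of $F^e$, the Cartier module $(R,C)$ has only finitely many Cartier submodules. Suppose moreover that $R$ is $F$-split and that $R$ is local with maximal ideal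 $\mathfrak m$ and $\mathfrak m$-adically complete, and let $d=\dim R$. 2. The injective hull $E_R$ of the residue field $R/\mathfrak m$ has a left $R[F]$-module structure for which it is anti-nilpotent and has only finitely many $R[F]$-submodules. 3. Suppose that $R$ is also quasi-Gorenstein, i.e. $H^d_{\mathfrak m}(R)\cong E_R$. Then $H^d_{\mathfrak m}(R)$, with its natural Frobenius action, is anti-nilpotent and has only finitely many $R[F]$-submodules. Here, for a system of parameters $x_1,\dots,x_d$ of $R$, $H^d_{\mathfrak m}(R)$ is the top cohomology $R_{x_1\cdots x_d}\big/\sum_i \operatorname{im}(R_{x_1\cdots \widehat{x_i}\cdots x_d})$ of the Čech complex, and the natural action is induced by $z\mapsto z^q$ on $R_{x_1\cdots x_d}$. -/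

import Mathlib

universe u

noncomputable section

namespace CartierPaper

/-! ### Cartier modules (right `R[F]`-modules), for the `q`-power Frobenius -/

section Cartier

variable {R M : Type*} [CommRing R] [AddCommGroup M] [Module R M]

/-- `C` is `q⁻¹`-linear, i.e. it is an `R`-linear map `F_* M → M` where `F` is the `q`-power
Frobenius; the pair `(M, C)` is then a Cartier module. -/
def IsCartierLinear (R : Type*) {M : Type*} [CommRing R] [AddCommGroup M] [Module R M]
    (q : ℕ) (C : M →+ M) : Prop :=
  ∀ (r : R) (m : M), C (r ^ q • m) = r • C m

/-- A Cartier submodule of `(M, C)`: an `R`-submodule `N` with `C(N) ⊆ N`. -/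
def IsCartierSubmodule (C : M →+ M) (N : Submodule R M) : Prop :=
  ∀ m ∈ N, C m ∈ N

/-- `C : F_* R → R` is an `R`-linear splitting of the `q`-power Frobenius `R → F_* R`. -/
def IsFrobeniusSplitting (q : ℕ) (C : R →+ R) : Prop :=
  IsCartierLinear R q C ∧ ∀ r : R, C (r ^ q) = r

end Cartier

/-! ### Left `R[F]`-modules

A left `R[F]`-module structure on an `R`-module `M`, for the `p ^ k`-power Frobenius, is an
additive map `φ : M → M` with `φ (r • m) = r ^ (p ^ k) • φ m`, that is, a map
`φ : M →ₛₗ[iterateFrobenius R p k] M`. -/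

section FModules

variable {R M : Type*} [CommRing R] [AddCommGroup M] [Module R M] {p k : ℕ} [ExpChar R p]

/-- The `R[F]`-submodules of `(M, φ)`: the `R`-submodules `N` with `φ(N) ⊆ N`. -/
def IsFSubmodule (φ : M →ₛₗ[iterateFrobenius R p k] M) (N : Submodule R M) : Prop :=
  ∀ m ∈ N, φ m ∈ N

/-- `(M, φ)` is anti-nilpotent: it has no nonzero nilpotent `R[F]`-subquotient `N' / N`
(nilpotent: some power `φ ^ n` vanishes on `N' / N`). -/
def IsAntiNilpotent (φ : M →ₛₗ[iterateFrobenius R p k] M) : Prop :=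
  ∀ N N' : Submodule R M, IsFSubmodule φ N → IsFSubmodule φ N' → N ≤ N' →
    (∃ n : ℕ, ∀ m ∈ N', φ^[n] m ∈ N) → N = N'

end FModules

/-- `E` is an injective hull of the `R`-module `K`: it is an injective module together with an
injective linear map `K → E` whose image is essential, i.e. meets every nonzero submodule. -/
def IsInjectiveHull (R K E : Type u) [CommRing R] [AddCommGroup K] [Module R K]
    [AddCommGroup E] [Module R E] : Prop :=
  Module.Injective R E ∧ ∃ ι : K →ₗ[R] E, Function.Injective ι ∧
    ∀ N : Submodule R E, N ⊓ LinearMap.range ι = ⊥ → N = ⊥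

/-- `x₁, …, x_d` is a system of parameters of the local ring `R`: `d = dim R`, and the `x i`
generate an ideal whose radical is the maximal ideal. -/
def IsSystemOfParameters {R : Type*} [CommRing R] [IsLocalRing R] {d : ℕ} (x : Fin d → R) : Prop :=
  ringKrullDim R = d ∧ (Ideal.span (Set.range x)).radical = IsLocalRing.maximalIdeal R

/-! ### Top local cohomology through the Čech complex -/

section LocalCohomology

/-- The localization map `R_f → R_g` when `f` divides `g`. -/
def awayMap {R : Type*} [CommRing R] {f g : R} (h : f ∣ g) :
    Localization.Away f →ₐ[R] Localization.Away g :=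
  IsLocalization.liftAlgHom (M := Submonoid.powers f)
    (f := Algebra.ofId R (Localization.Away g)) (by
      rintro ⟨_, n, rfl⟩
      rw [map_pow]
      exact (isUnit_of_dvd_unit (map_dvd (algebraMap R (Localization.Away g)) h)
        (IsLocalization.Away.algebraMap_isUnit g)).pow n)

variable {R : Type u} [CommRing R] {d : ℕ} (x : Fin d → R)

/-- The last differential of the Čech complex of `R` on `x₁, …, x_d`, namely
`∏ i, R_{x₁ ⋯ x̂ᵢ ⋯ x_d} → R_{x₁ ⋯ x_d}`, `(zᵢ) ↦ ∑ i, (-1)ⁱ zᵢ`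
(if `d = 0`, the map `0 → R`). -/
def cechTopDifferential :
    ((i : Fin d) → Localization.Away (∏ j ∈ Finset.univ.erase i, x j)) →ₗ[R]
      Localization.Away (∏ j, x j) :=
  ∑ i : Fin d, (-1 : R) ^ (i : ℕ) •
    ((awayMap (Finset.prod_dvd_prod_of_subset _ _ x
      (Finset.erase_subset i Finset.univ))).toLinearMap ∘ₗ LinearMap.proj i)

/-- The `d`-th (top) cohomology of the Čech complex of `R` on `x₁, …, x_d`. If `x₁, …, x_d` is a
system of parameters of a Noetherian local ring `(R, 𝔪)`, this is `H^d_𝔪(R)`. -/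
abbrev TopLocalCohomology : Type u :=
  Localization.Away (∏ j, x j) ⧸ LinearMap.range (cechTopDifferential x)

variable (p k : ℕ) [Fact p.Prime] [CharP R p]

/-- The `p ^ k`-power Frobenius of an algebra `A` over a ring `R` of characteristic `p`, as a
Frobenius-semilinear map of `R`-modules. -/
def algebraFrobenius {R : Type*} [CommRing R] (p k : ℕ) [Fact p.Prime] [CharP R p]
    (A : Type*) [CommRing A] [Algebra R A] :
    A →ₛₗ[iterateFrobenius R p k] A where
  toFun z := z ^ p ^ k
  map_add' a b := by
    obtain ⟨r, hr⟩ := exists_add_pow_prime_pow_eq (R := A) (Fact.out : p.Prime) a b k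
    have hp : (p : A) = 0 := by
      rw [← map_natCast (algebraMap R A) p, CharP.cast_eq_zero, map_zero]
    simp [hr, hp]
  map_smul' r a := by
    rw [smul_pow, iterateFrobenius_def]

theorem algebraFrobenius_mem_range (z : Localization.Away (∏ j, x j))
    (hz : z ∈ LinearMap.range (cechTopDifferential x)) :
    algebraFrobenius (R := R) p k (Localization.Away (∏ j, x j)) z ∈
      LinearMap.range (cechTopDifferential x) := by
  obtain ⟨y, rfl⟩ := hz
  refine ⟨fun i => (-1 : R) ^ (i : ℕ) • ((-1 : R) ^ (i : ℕ) • y i) ^ p ^ k, ?_⟩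
  simp only [cechTopDifferential, LinearMap.sum_apply, map_sum]
  refine Finset.sum_congr rfl fun i _ => ?_
  simp only [LinearMap.smul_apply, LinearMap.comp_apply, LinearMap.proj_apply,
    AlgHom.toLinearMap_apply, map_smul, map_pow, smul_smul, ← mul_pow, neg_mul_neg, one_mul,
    one_pow, one_smul]
  rfl

/-- The natural Frobenius action on the top local cohomology: the map induced on the top
cohomology of the Čech complex by the `p ^ k`-power Frobenius of its terms, so that the class of
`a / (x₁ ⋯ x_d) ^ t` goes to the class of `a ^ (p ^ k) / (x₁ ⋯ x_d) ^ (t * p ^ k)`. -/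
def frobeniusTopLocalCohomology :
    TopLocalCohomology x →ₛₗ[iterateFrobenius R p k] TopLocalCohomology x :=
  Submodule.mapQ _ _ (algebraFrobenius p k (Localization.Away (∏ j, x j)))
    (algebraFrobenius_mem_range x p k)

end LocalCohomology

end CartierPaper

end

/-!
**Finiteness of Cartier ideals.** Let `C` be a splitting of the `Q`-power Frobenius. Since
`C (r ^ Q) = r`, every `C`-stable ideal is radical; sums, intersections and colons of `C`-stable
ideals are `C`-stable. By Noetherian induction it suffices to bound the `C`-stable ideals
containing a `C`-stable ideal `I` once those containing any strictly larger `C`-stable ideal are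
known to be finite in number. If `I` is not prime, two larger colon ideals `I₁`, `I₂` with
`I₁ * I₂ ≤ I` determine each radical `J ≥ I` as `(J + I₁) ∩ (J + I₂)`. If `I` is prime, pass to the
domain `A = R ⧸ I`: the form `C` on the finite extension `A ^ Q ⊆ A` has a dual basis up to a
denominator, `c * x = ∑ i, C (a i * x) ^ Q * b i` (`exists_dualFrame`). Hence a nonzero `C`-stable
ideal `J` of `A` satisfies `c J ⊆ J ^ 2`, so a power of `c`, and then `c` itself, lies in `J`. All
`C`-stable ideals strictly above `I` therefore contain a fixed strictly larger one
(`finite_cartierSubmodule`).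

**The injective hull.** If `R` is complete, then every endomorphism of the injective hull `E` of the
residue field is a homothety, so submodules of `E` are determined by their annihilators
(`IsInjectiveHull.exists_eq_smul`, `IsInjectiveHull.le_of_annihilator_le`). Moreover
`Hom_R(F_* R, E)` is again an injective hull over `F_* R`, so there is a map `t : F_* E → E` through
which `C` dualizes to a semilinear map `φ` on `E` with `t (s • φ z) = C s • z`
(`IsInjectiveHull.exists_trace`, `IsInjectiveHull.exists_semilinear_dual`). Annihilators of
`φ`-stable submodules are `C`-stable, which gives finiteness; and `φ ^ n (N') ⊆ N` gives
`C ^ n (Ann N) ⊆ Ann N'`, while `Ann N ⊆ C ^ n (Ann N)` because `C` is a splitting, which gives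
anti-nilpotence.

**The quasi-Gorenstein case.** The Frobenius action `f` on top local cohomology is universal: any
semilinear map `φ` is `g ∘ f` with `g` linear
(`exists_linearMap_comp_frobeniusTopLocalCohomology`). If the top local cohomology is `E`, then `g`
is the homothety by some `u`, so `f`-stable submodules are stable under `φ = u f`, and both
properties pass from `φ` to `f`.
-/

namespace CartierPaper

/-! ### Dual bases for a linear form on a finite extension of domains -/

section DualFrame

variable {B A : Type*} [CommRing B] [IsDomain B] [CommRing A] [IsDomain A]

/-- A nonzero `B`-linear form `T` on a finite extension `A` of domains has, up to the common
denominator `c`, a dual basis for the pairing `(x, y) ↦ T (x * y)`: that pairing is nondegenerate on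
a maximal linearly independent family, and the adjugate of its Gram matrix gives the `a i`. -/
theorem exists_dualFrame_of_algebra [Algebra B A] [Module.Finite B A]
    (hinj : Function.Injective (algebraMap B A)) (T : A →ₗ[B] B) (hT : T ≠ 0) :
    ∃ (c : A) (n : ℕ) (a b : Fin n → A), c ≠ 0 ∧
      ∀ x, c * x = ∑ i, T (a i * x) • b i := by
  classical
  have : Module.IsTorsionFree B A := by
    rw [← faithfulSMul_iff_algebraMap_injective B A] at hinj
    infer_instance
  obtain ⟨m, g, hg⟩ := Module.Finite.exists_fin (R := B) (M := A)
  obtain ⟨s, hs, hmax⟩ := exists_maximal_linearIndepOn B g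
  have hfrac : ∀ x : A, ∃ r : B, r ≠ 0 ∧ r • x ∈ Submodule.span B (g '' s) := by
    intro x
    have hx : x ∈ Submodule.span B (Set.range g) := hg ▸ Submodule.mem_top
    induction hx using Submodule.span_induction with
    | mem x hx =>
      obtain ⟨i, rfl⟩ := hx
      by_cases hi : i ∈ s
      · exact ⟨1, one_ne_zero, by
          rw [one_smul]; exact Submodule.subset_span (Set.mem_image_of_mem g hi)⟩
      · exact hmax i hi
    | zero => exact ⟨1, one_ne_zero, by simp⟩
    | add x y _ _ hx hy =>
      obtain ⟨r, hr, hrx⟩ := hx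
      obtain ⟨t, ht, hty⟩ := hy
      refine ⟨r * t, mul_ne_zero hr ht, ?_⟩
      rw [smul_add, mul_smul, mul_smul, smul_comm r t x]
      exact add_mem (Submodule.smul_mem _ _ hrx) (Submodule.smul_mem _ _ hty)
    | smul t x _ hx =>
      obtain ⟨r, hr, hrx⟩ := hx
      exact ⟨r, hr, by rw [smul_comm]; exact Submodule.smul_mem _ _ hrx⟩
  -- a maximal independent family `b` and its Gram matrix for `(x, y) ↦ T (x * y)`
  let e := Fintype.equivFin s
  let b : Fin (Fintype.card s) → A := fun i => g (e.symm i)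
  have hspan : Submodule.span B (Set.range b) = Submodule.span B (g '' s) := by
    congr 1
    ext y
    constructor
    · rintro ⟨i, rfl⟩
      exact ⟨_, (e.symm i).2, rfl⟩
    · rintro ⟨i, hi, rfl⟩
      exact ⟨e ⟨i, hi⟩, by simp [b]⟩
  have hb : LinearIndependent B b := hs.comp e.symm e.symm.injective
  let G : Matrix (Fin (Fintype.card s)) (Fin (Fintype.card s)) B :=
    Matrix.of fun i j => T (b i * b j)
  have hdet : G.det ≠ 0 := by
    intro h0
    obtain ⟨v, hv0, hv⟩ := Matrix.exists_mulVec_eq_zero_iff.mpr h0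
    set y : A := ∑ j, v j • b j with hy
    have hy0 : y ≠ 0 := fun h => hv0 (funext (Fintype.linearIndependent_iff.mp hb v h))
    have hz : ∀ z, T (z * y) = 0 := by
      intro z
      obtain ⟨r, hr, hrz⟩ := hfrac z
      rw [← hspan] at hrz
      have hspan0 : ∀ x ∈ Submodule.span B (Set.range b), T (x * y) = 0 := by
        intro x hx
        induction hx using Submodule.span_induction with
        | mem x hx =>
          obtain ⟨i, rfl⟩ := hx
          have := congrFun hv i
          simp only [G, Matrix.mulVec, dotProduct, Matrix.of_apply, Pi.zero_apply] at this
          rw [hy, Finset.mul_sum, map_sum, ← this]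
          refine Finset.sum_congr rfl fun j _ => ?_
          rw [mul_smul_comm, map_smul, smul_eq_mul, mul_comm]
        | zero => simp
        | add x y _ _ hx hy => rw [add_mul, map_add, hx, hy, add_zero]
        | smul t x _ hx => rw [smul_mul_assoc, map_smul, hx, smul_zero]
      have := hspan0 _ hrz
      rw [smul_mul_assoc, map_smul, smul_eq_mul] at this
      exact (mul_eq_zero.mp this).resolve_left hr
    -- by integrality a multiple of `y` is a nonzero element of `B`
    have : Algebra.IsIntegral B A := inferInstance
    obtain ⟨t, ht0, ht⟩ : ∃ t : B, t ≠ 0 ∧ algebraMap B A t ∈ Ideal.span {y} := by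
      have hne : Ideal.comap (algebraMap B A) (Ideal.span {y}) ≠ ⊥ :=
        Ideal.comap_ne_bot_of_integral_mem hy0 (Ideal.mem_span_singleton_self y)
          (Algebra.IsIntegral.isIntegral y)
      obtain ⟨t, ht, ht0⟩ := Submodule.exists_mem_ne_zero_of_ne_bot hne
      exact ⟨t, ht0, ht⟩
    obtain ⟨w, hw⟩ := Ideal.mem_span_singleton'.mp ht
    refine hT (LinearMap.ext fun z => ?_)
    have h1 : T ((z * w) * y) = 0 := hz _
    rw [mul_assoc, hw, mul_comm, ← Algebra.smul_def, map_smul, smul_eq_mul] at h1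
    exact (mul_eq_zero.mp h1).resolve_left ht0
  refine ⟨algebraMap B A G.det, _, fun i => ∑ j, G.adjugate i j • b j, b,
    (map_ne_zero_iff _ hinj).mpr hdet, fun x => ?_⟩
  have key : ∀ x ∈ Submodule.span B (Set.range b),
      G.det • x = ∑ i, T ((∑ j, G.adjugate i j • b j) * x) • b i := by
    intro x hx
    induction hx using Submodule.span_induction with
    | mem x hx =>
      obtain ⟨l, rfl⟩ := hx
      have hl : ∀ i, T ((∑ j, G.adjugate i j • b j) * b l) = (G.adjugate * G) i l := by
        intro i
        rw [Finset.sum_mul, map_sum, Matrix.mul_apply]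
        refine Finset.sum_congr rfl fun j _ => ?_
        rw [smul_mul_assoc, map_smul, smul_eq_mul]
        rfl
      simp only [hl, Matrix.adjugate_mul, Matrix.smul_apply, Matrix.one_apply, smul_eq_mul,
        mul_ite, mul_one, mul_zero, ite_smul, zero_smul, Finset.sum_ite_eq', Finset.mem_univ,
        if_true]
    | zero => simp
    | add x y _ _ hx hy =>
      rw [smul_add, hx, hy, ← Finset.sum_add_distrib]
      exact Finset.sum_congr rfl fun i _ => by rw [mul_add, map_add, add_smul]
    | smul t x _ hx =>
      rw [smul_comm, hx, Finset.smul_sum]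
      exact Finset.sum_congr rfl fun i _ => by
        rw [mul_smul_comm, map_smul, smul_assoc]
  obtain ⟨r, hr, hrx⟩ := hfrac x
  rw [← hspan] at hrx
  have h := key _ hrx
  -- multiplication by `r` moves `x` into the span and can be cancelled
  refine smul_right_injective A hr ?_
  simp only
  rw [← Algebra.smul_def, smul_comm, h, Finset.smul_sum]
  exact Finset.sum_congr rfl fun i _ => by rw [mul_smul_comm, map_smul, smul_assoc]

/-- The dual basis property for a ring homomorphism `f : B → A` instead of an algebra, so that `A`
and `B` may be the same ring. -/
theorem exists_dualFrame (f : B →+* A) (hinj : Function.Injective f) (hfin : f.Finite)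
    (T : A →+ B) (hT : ∀ b a, T (f b * a) = b * T a) (hT0 : ∃ a, T a ≠ 0) :
    ∃ (c : A) (n : ℕ) (a b : Fin n → A), c ≠ 0 ∧
      ∀ x, c * x = ∑ i, f (T (a i * x)) * b i := by
  let := f.toAlgebra
  have : Module.Finite B A := hfin
  let T' : A →ₗ[B] B := { T with map_smul' := fun b a => hT b a }
  exact exists_dualFrame_of_algebra (B := B) hinj T' fun h =>
    hT0.elim fun a ha => ha (LinearMap.congr_fun h a)

end DualFrame

/-! ### Finiteness of the set of Cartier submodules of a Frobenius splitting -/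

section CartierIdeals

variable {R : Type*} [CommRing R] {Q : ℕ} {C : R →+ R}

theorem IsCartierLinear.map_pow_mul (hC : IsCartierLinear R Q C) (r s : R) :
    C (r ^ Q * s) = r * C s := hC r s

namespace IsCartierSubmodule

theorem isRadical (hQ : 2 ≤ Q) (hC : IsFrobeniusSplitting Q C) {I : Ideal R}
    (hI : IsCartierSubmodule C I) : I.IsRadical := by
  have key : ∀ n (r : R), r ^ Q ^ n ∈ I → r ∈ I := by
    intro n
    induction n with
    | zero => intro r hr; simpa using hr
    | succ n ih =>
      intro r hr
      refine ih r ?_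
      rw [← hC.2 (r ^ Q ^ n)]
      refine hI _ ?_
      rwa [← pow_mul, ← pow_succ]
  rintro r ⟨n, hn⟩
  exact key n r (I.pow_mem_of_pow_mem hn (Nat.lt_pow_self hQ).le)

theorem sup {I J : Ideal R} (hI : IsCartierSubmodule C I) (hJ : IsCartierSubmodule C J) :
    IsCartierSubmodule C (I ⊔ J : Ideal R) := by
  intro m hm
  obtain ⟨a, ha, b, hb, rfl⟩ := Submodule.mem_sup.mp hm
  rw [map_add]
  exact Submodule.add_mem_sup (hI a ha) (hJ b hb)

theorem sInf {S : Set (Ideal R)} (hS : ∀ I ∈ S, IsCartierSubmodule C I) :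
    IsCartierSubmodule C (sInf S : Ideal R) := by
  intro m hm
  rw [Submodule.mem_sInf] at hm ⊢
  exact fun I hI => hS I hI m (hm I hI)

theorem colon (hQ : Q ≠ 0) (hC : IsCartierLinear R Q C) {I : Ideal R}
    (hI : IsCartierSubmodule C I) (S : Set R) :
    IsCartierSubmodule C (Submodule.colon I S : Ideal R) := by
  intro m hm
  rw [Submodule.mem_colon] at hm ⊢
  intro s hs
  rw [smul_eq_mul, mul_comm, ← hC.map_pow_mul]
  refine hI _ ?_
  obtain ⟨n, rfl⟩ := Nat.exists_eq_succ_of_ne_zero hQ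
  rw [pow_succ, mul_assoc, mul_comm s m]
  exact I.mul_mem_left _ (hm s hs)

end IsCartierSubmodule

/-- The Cartier ideals of a splitting on a domain have a common nonzero element. -/
theorem exists_ne_zero_mem_cartierSubmodule [IsDomain R] [IsNoetherianRing R] (hQ : 2 ≤ Q)
    (F : R →+* R) (hF : ∀ r, F r = r ^ Q) (hfin : F.Finite)
    (hC : IsFrobeniusSplitting Q C) :
    ∃ c : R, c ≠ 0 ∧ ∀ J : Ideal R, IsCartierSubmodule C J → J ≠ ⊥ → c ∈ J := by
  have hinj : Function.Injective F := by
    intro x y hxy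
    rw [← hC.2 x, ← hC.2 y, ← hF, ← hF, hxy]
  obtain ⟨c, n, a, b, hc, h⟩ := exists_dualFrame F hinj hfin C
    (fun r s => by rw [hF]; exact hC.1 r s) ⟨1, by
      have := hC.2 1
      rw [one_pow] at this
      rw [this]; exact one_ne_zero⟩
  refine ⟨c, hc, fun J hJ hJ0 => ?_⟩
  -- `c J ⊆ J ^ Q ⊆ J * J`
  have hcJ : ∀ x ∈ J, c * x ∈ J * J := by
    intro x hx
    rw [h x]
    refine Ideal.sum_mem _ fun i _ => Ideal.mul_mem_right _ _ ?_
    have hmem : C (a i * x) ∈ J := hJ _ (J.mul_mem_left _ hx)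
    rw [hF, ← pow_two]
    exact Ideal.pow_le_pow_right hQ (Ideal.pow_mem_pow hmem Q)
  -- the determinant trick
  let μ : Module.End R J := LinearMap.lsmul R J c
  have hrange : LinearMap.range μ ≤ J • (⊤ : Submodule R J) := by
    rintro _ ⟨x, rfl⟩
    have hx := hcJ x x.2
    have hmap : J * J = (J • (⊤ : Submodule R J)).map J.subtype := by
      rw [Submodule.map_smul'', Submodule.map_top, Submodule.range_subtype, smul_eq_mul]
    rw [hmap] at hx
    obtain ⟨y, hy, hyx⟩ := hx
    rwa [show μ x = y from Subtype.ext hyx.symm]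
  obtain ⟨P, hP, -, hcoef, haev⟩ :=
    LinearMap.exists_monic_and_natDegree_eq_and_coeff_mem_pow_and_aeval_eq_zero R μ J hrange
  obtain ⟨x, hxJ, hx0⟩ := Submodule.exists_mem_ne_zero_of_ne_bot hJ0
  have hev : P.eval c = 0 := by
    have h1 : Polynomial.aeval μ P = LinearMap.lsmul R J (P.eval c) := by
      have : μ = algebraMap R (Module.End R J) c := rfl
      rw [this, Polynomial.aeval_algebraMap_apply]
      simp only [Polynomial.coe_aeval_eq_eval]
      rfl
    have h2 := congrArg Subtype.val (LinearMap.congr_fun (h1.symm.trans haev) ⟨x, hxJ⟩)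
    exact (mul_eq_zero.mp h2).resolve_right hx0
  refine hJ.isRadical hQ hC ⟨P.natDegree, ?_⟩
  rw [Polynomial.eval_eq_sum_range, Finset.sum_range_succ, hP.coeff_natDegree, one_mul] at hev
  rw [eq_neg_of_add_eq_zero_right hev, neg_mem_iff]
  refine Ideal.sum_mem _ fun i hi => Ideal.mul_mem_right _ _ ?_
  exact Ideal.pow_le_self (Nat.sub_ne_zero_of_lt (Finset.mem_range.mp hi)) (hcoef i)

/-- A splitting `C` descends to `R ⧸ I` for every `C`-stable ideal `I`. -/
theorem exists_cartierQuotient (F : R →+* R) (hF : ∀ r, F r = r ^ Q) (hfin : F.Finite)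
    (hC : IsFrobeniusSplitting Q C) (hQ : Q ≠ 0) {I : Ideal R} (hI : IsCartierSubmodule C I) :
    ∃ (F' : R ⧸ I →+* R ⧸ I) (C' : R ⧸ I →+ R ⧸ I), (∀ r, F' r = r ^ Q) ∧ F'.Finite ∧
      IsFrobeniusSplitting Q C' ∧
      ∀ r, C' (Ideal.Quotient.mk I r) = Ideal.Quotient.mk I (C r) := by
  have hIF : I ≤ I.comap F := fun x hx => by
    rw [Ideal.mem_comap, hF]
    exact Ideal.pow_mem_of_mem _ hx _ (Nat.pos_of_ne_zero hQ)
  refine ⟨Ideal.quotientMap I F hIF,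
    QuotientAddGroup.map I.toAddSubgroup I.toAddSubgroup C (fun x hx => hI x hx), ?_, ?_,
    ⟨?_, ?_⟩, fun r => rfl⟩
  · intro r
    obtain ⟨r, rfl⟩ := Ideal.Quotient.mk_surjective r
    rw [Ideal.quotientMap_mk, hF, map_pow]
  · refine RingHom.Finite.of_comp_finite (f := Ideal.Quotient.mk I) ?_
    rw [Ideal.quotientMap_comp_mk]
    exact (RingHom.Finite.of_surjective _ Ideal.Quotient.mk_surjective).comp hfin
  · intro r m
    obtain ⟨r, rfl⟩ := Ideal.Quotient.mk_surjective r
    obtain ⟨m, rfl⟩ := Ideal.Quotient.mk_surjective m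
    exact congrArg (Ideal.Quotient.mk I) (hC.1 r m)
  · intro r
    obtain ⟨r, rfl⟩ := Ideal.Quotient.mk_surjective r
    exact congrArg (Ideal.Quotient.mk I) (hC.2 r)

/-- A splitting of a Frobenius on a Noetherian ring, finite over it, has finitely many stable
ideals. -/
theorem finite_cartierSubmodule [IsNoetherianRing R] (hQ : 2 ≤ Q)
    (F : R →+* R) (hF : ∀ r, F r = r ^ Q) (hfin : F.Finite) (hC : IsFrobeniusSplitting Q C) :
    {I : Ideal R | IsCartierSubmodule C I}.Finite := by
  suffices H : ∀ I : Ideal R, IsCartierSubmodule C I →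
      {J : Ideal R | IsCartierSubmodule C J ∧ I ≤ J}.Finite by
    refine (H ⊥ ?_).subset fun J hJ => ⟨hJ, bot_le⟩
    intro m hm
    rw [Submodule.mem_bot] at hm ⊢
    rw [hm, map_zero]
  intro I
  induction I using WellFoundedGT.induction with
  | ind I ih =>
  intro hI
  have hQ0 : Q ≠ 0 := by omega
  by_cases htop : I = ⊤
  · refine (Set.finite_singleton ⊤).subset fun J hJ => ?_
    rw [htop] at hJ
    exact top_le_iff.mp hJ.2
  by_cases hprime : I.IsPrime
  · obtain ⟨F', C', hF', hfin', hC', hCC'⟩ :=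
      exists_cartierQuotient F hF hfin hC (by omega) hI
    obtain ⟨c, hc0, hc⟩ := exists_ne_zero_mem_cartierSubmodule hQ F' hF' hfin' hC'
    obtain ⟨c, rfl⟩ := Ideal.Quotient.mk_surjective c
    have hcI : c ∉ I := fun h => hc0 (Ideal.Quotient.eq_zero_iff_mem.mpr h)
    -- the stable ideals strictly above `I` contain `c`, so their intersection is larger than `I`
    set S : Set (Ideal R) := {J | IsCartierSubmodule C J ∧ I < J} with hS
    have hcS : ∀ J ∈ S, c ∈ J := by
      rintro J ⟨hJ, hIJ⟩
      have hmem := hc (J.map (Ideal.Quotient.mk I)) ?_ ?_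
      · rwa [Ideal.mem_quotient_iff_mem hIJ.le] at hmem
      · intro m hm
        obtain ⟨m, rfl⟩ := Ideal.Quotient.mk_surjective m
        rw [hCC']
        rw [Ideal.mem_quotient_iff_mem hIJ.le] at hm ⊢
        exact hJ m hm
      · intro h0
        rw [Ideal.map_eq_bot_iff_le_ker, Ideal.mk_ker] at h0
        exact hIJ.not_ge h0
    have hlt : I < sInf S :=
      lt_of_le_of_ne (le_sInf fun J hJ => hJ.2.le) fun h =>
        hcI (h ▸ Submodule.mem_sInf.mpr hcS)
    refine ((ih _ hlt (IsCartierSubmodule.sInf fun J hJ => hJ.1)).insert I).subset ?_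
    rintro J ⟨hJ, hIJ⟩
    rcases hIJ.eq_or_lt with h | h
    · exact Or.inl h.symm
    · exact Or.inr ⟨hJ, sInf_le ⟨hJ, h⟩⟩
  · obtain ⟨a, ha, b, hb, hab⟩ : ∃ a ∉ I, ∃ b ∉ I, a * b ∈ I := by
      by_contra hcon
      push Not at hcon
      refine hprime ⟨htop, fun {x y} hxy => ?_⟩
      by_contra hxy'
      push Not at hxy'
      exact hcon x hxy'.1 y hxy'.2 hxy
    set I₁ : Ideal R := Submodule.colon I {a} with hI₁
    set I₂ : Ideal R := Submodule.colon I (I₁ : Set R) with hI₂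
    have h₁ : IsCartierSubmodule C I₁ := hI.colon hQ0 hC.1 _
    have h₂ : IsCartierSubmodule C I₂ := hI.colon hQ0 hC.1 _
    have hlt₁ : I < I₁ := by
      refine lt_of_le_of_ne (fun x hx => ?_) fun h => hb (h ▸ ?_)
      · exact Submodule.mem_colon.mpr fun s _ => I.mul_mem_right _ hx
      · rwa [hI₁, Submodule.mem_colon_singleton, smul_eq_mul, mul_comm]
    have hlt₂ : I < I₂ := by
      refine lt_of_le_of_ne (fun x hx => ?_) fun h => ha (h ▸ ?_)
      · exact Submodule.mem_colon.mpr fun s _ => I.mul_mem_right _ hx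
      · refine Submodule.mem_colon.mpr fun s hs => ?_
        rw [SetLike.mem_coe, hI₁, Submodule.mem_colon_singleton, smul_eq_mul] at hs
        rwa [smul_eq_mul, mul_comm]
    refine (((ih _ hlt₁ h₁).prod (ih _ hlt₂ h₂)).image
      fun K : Ideal R × Ideal R => K.1 ⊓ K.2).subset ?_
    rintro J ⟨hJ, hIJ⟩
    refine ⟨(J ⊔ I₁, J ⊔ I₂), ⟨⟨hJ.sup h₁, le_sup_right⟩, hJ.sup h₂, le_sup_right⟩, ?_⟩
    -- a radical ideal `J ⊇ I₁ * I₂` is the intersection of `J + I₁` and `J + I₂`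
    refine le_antisymm (fun x hx => ?_) (le_inf le_sup_left le_sup_left)
    refine hJ.isRadical hQ hC ⟨2, ?_⟩
    rw [pow_two]
    have hle : (J ⊔ I₁) * (J ⊔ I₂) ≤ J := by
      rw [Ideal.sup_mul, Ideal.mul_sup I₁]
      refine sup_le Ideal.mul_le_left (sup_le Ideal.mul_le_right ?_)
      refine Ideal.mul_le.mpr fun r hr s hs => hIJ ?_
      rw [mul_comm]
      exact Submodule.mem_colon.mp hs r hr
    exact hle (Ideal.mul_mem_mul hx.1 hx.2)

end CartierIdeals

/-! ### Matlis duality over a complete local ring -/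

section Matlis

open IsLocalRing

theorem isFiniteLength_of_pow_maximalIdeal_smul_eq_zero {R M : Type*} [CommRing R]
    [IsNoetherianRing R] [IsLocalRing R] [AddCommGroup M] [Module R M] [Module.Finite R M] (n : ℕ)
    (h : ∀ r ∈ maximalIdeal R ^ n, ∀ x : M, r • x = 0) : IsFiniteLength R M := by
  rw [isFiniteLength_iff_isNoetherian_isArtinian]
  refine ⟨inferInstance, ?_⟩
  set I := maximalIdeal R ^ n
  have hquot : IsArtinian R (R ⧸ I) := by
    rcases subsingleton_or_nontrivial (R ⧸ I) with hsub | hnt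
    · infer_instance
    have hring : IsArtinianRing (R ⧸ I) := by
      have := IsLocalRing.of_surjective' (Ideal.Quotient.mk I) Ideal.Quotient.mk_surjective
      rw [isArtinianRing_iff_isNilpotent_maximalIdeal]
      refine ⟨n, ?_⟩
      have hmap : (maximalIdeal R).map (Ideal.Quotient.mk I) = maximalIdeal (R ⧸ I) := by
        have := IsLocalHom.of_surjective (Ideal.Quotient.mk I) Ideal.Quotient.mk_surjective
        ext x
        obtain ⟨x, rfl⟩ := Ideal.Quotient.mk_surjective x
        have hI : I ≠ ⊤ := Ideal.Quotient.nontrivial_iff.mp hnt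
        simp [sup_eq_left.mpr (le_maximalIdeal hI)]
      rw [← hmap, ← Ideal.map_pow, Ideal.zero_eq_bot, Ideal.map_eq_bot_iff_le_ker, Ideal.mk_ker]
    exact isArtinian_of_surjective_algebraMap (R := R ⧸ I) Ideal.Quotient.mk_surjective
  obtain ⟨k, g, hg⟩ := Module.Finite.exists_fin (R := R) (M := M)
  let f : (Fin k → R ⧸ I) →ₗ[R] M := LinearMap.lsum R (fun _ => R ⧸ I) R fun i =>
    Submodule.liftQ I (LinearMap.toSpanSingleton R M (g i)) fun r hr => h r hr _
  refine isArtinian_of_surjective _ f (LinearMap.range_eq_top.mp (top_le_iff.mp ?_))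
  rw [← hg, Submodule.span_le]
  rintro _ ⟨i, rfl⟩
  refine ⟨Pi.single i (Ideal.Quotient.mk I 1), ?_⟩
  simp only [f, LinearMap.lsum_piSingle]
  exact one_smul R (g i)

variable {R E : Type u} [CommRing R] [IsLocalRing R] [AddCommGroup E] [Module R E]

namespace IsInjectiveHull

variable (hE : IsInjectiveHull R (ResidueField R) E)
include hE

theorem exists_residueField_embedding : ∃ ι : ResidueField R →ₗ[R] E, Function.Injective ι ∧
    ∀ N : Submodule R E, N ≠ ⊥ → ι 1 ∈ N := by
  obtain ⟨-, ι, hι, hess⟩ := hE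
  refine ⟨ι, hι, fun N hN => ?_⟩
  obtain ⟨z, ⟨hzN, k, rfl⟩, hz⟩ := Submodule.exists_mem_ne_zero_of_ne_bot (mt (hess N) hN)
  have hk : k ≠ 0 := fun h => hz (by rw [h, map_zero])
  obtain ⟨r, hr⟩ := residue_surjective (R := R) k⁻¹
  have : ι 1 = r • ι k := by
    rw [← map_smul, Algebra.smul_def, ResidueField.algebraMap_eq, hr, inv_mul_cancel₀ hk]
  rw [this]
  exact N.smul_mem _ hzN

/-- A generator of the socle: a nonzero element killed by the maximal ideal and contained in every
nonzero submodule. -/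
theorem exists_socle_generator : ∃ w : E, w ≠ 0 ∧ (∀ r ∈ maximalIdeal R, r • w = 0) ∧
    ∀ N : Submodule R E, N ≠ ⊥ → w ∈ N := by
  obtain ⟨ι, hι, hN⟩ := hE.exists_residueField_embedding
  refine ⟨ι 1, (map_ne_zero_iff _ hι).mpr one_ne_zero, fun r hr => ?_, hN⟩
  rw [← map_smul, Algebra.smul_def, mul_one, ResidueField.algebraMap_eq,
    (residue_eq_zero_iff r).mpr hr, map_zero]

/-- An injective hull of the residue field is a cogenerator. -/
theorem exists_hom_ne_zero {M : Type u} [AddCommGroup M] [Module R M] {x : M} (hx : x ≠ 0) :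
    ∃ h : M →ₗ[R] E, h x ≠ 0 := by
  obtain ⟨w, hw0, hw, -⟩ := hE.exists_socle_generator
  have hle : Ideal.torsionOf R M x ≤ maximalIdeal R := by
    refine le_maximalIdeal fun h => hx ?_
    exact (Ideal.torsionOf_eq_top_iff (R := R) x).mp h
  let g : (R ⧸ Ideal.torsionOf R M x) →ₗ[R] E :=
    Submodule.liftQ _ (LinearMap.toSpanSingleton R E w) fun r hr => hw r (hle hr)
  let e := Ideal.quotTorsionOfEquivSpanSingleton R M x
  obtain ⟨h, hh⟩ := hE.1.out (Submodule.span R {x}).subtype Subtype.val_injective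
    (g ∘ₗ e.symm.toLinearMap)
  refine ⟨h, ?_⟩
  have he : e (Submodule.Quotient.mk 1) = (1 : R) • ⟨x, Submodule.mem_span_singleton_self x⟩ :=
    Ideal.quotTorsionOfEquivSpanSingleton_apply_mk x 1
  have h1 := hh (e (Submodule.Quotient.mk 1))
  rw [LinearMap.comp_apply, LinearEquiv.coe_coe, LinearEquiv.symm_apply_apply, he, one_smul] at h1
  rw [show h x = (1 : R) • w from h1, one_smul]
  exact hw0

omit hE in
theorem mem_span_of_smul_eq_zero {w z : E} (hw : ∀ N : Submodule R E, N ≠ ⊥ → w ∈ N)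
    (hw0 : w ≠ 0) (hz : ∀ r ∈ maximalIdeal R, r • z = 0) : z ∈ Submodule.span R {w} := by
  by_cases hz0 : z = 0
  · rw [hz0]; exact zero_mem _
  obtain ⟨r, rfl⟩ := Submodule.mem_span_singleton.mp
    (hw (Submodule.span R {z}) (by rwa [Ne, Submodule.span_singleton_eq_bot]))
  have hr : IsUnit r := by
    by_contra hr
    exact hw0 (hz r ((mem_maximalIdeal r).mpr hr))
  obtain ⟨s, rfl⟩ := hr
  exact Submodule.mem_span_singleton.mpr ⟨((s⁻¹ : Rˣ) : R), by
    rw [smul_smul, Units.inv_mul, one_smul]⟩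

/-- Every element of an injective hull of the residue field is killed by a power of the maximal
ideal. -/
theorem exists_pow_smul_eq_zero [IsNoetherianRing R] (x : E) :
    ∃ n, ∀ r ∈ maximalIdeal R ^ n, r • x = 0 := by
  obtain ⟨w, hw0, -, hw⟩ := hE.exists_socle_generator
  by_cases hx : x = 0
  · exact ⟨0, fun r _ => by rw [hx, smul_zero]⟩
  set M := Submodule.span R {x} with hM
  have hwM : w ∈ M := hw M (by rwa [Ne, hM, Submodule.span_singleton_eq_bot])
  have hkrull := (maximalIdeal R).iInf_pow_smul_eq_bot_of_isLocalRing (M := M)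
    (Ideal.IsPrime.ne_top inferInstance)
  obtain ⟨n, hn⟩ : ∃ n, (⟨w, hwM⟩ : M) ∉ (maximalIdeal R ^ n • ⊤ : Submodule R M) := by
    by_contra hcon
    push Not at hcon
    have : (⟨w, hwM⟩ : M) ∈ (⨅ n, maximalIdeal R ^ n • ⊤ : Submodule R M) :=
      (Submodule.mem_iInf _).mpr hcon
    rw [hkrull, Submodule.mem_bot] at this
    exact hw0 (congrArg Subtype.val this)
  refine ⟨n, fun r hr => ?_⟩
  have hbot : (maximalIdeal R ^ n • ⊤ : Submodule R M).map M.subtype = ⊥ := by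
    by_contra hcon
    obtain ⟨y, hy, hyw⟩ := hw _ hcon
    exact hn (by rwa [show (⟨w, hwM⟩ : M) = y from Subtype.ext hyw.symm])
  have hmem : r • x ∈ (maximalIdeal R ^ n • ⊤ : Submodule R M).map M.subtype :=
    ⟨r • ⟨x, Submodule.mem_span_singleton_self x⟩,
      Submodule.smul_mem_smul hr Submodule.mem_top, rfl⟩
  rwa [hbot, Submodule.mem_bot] at hmem

theorem exists_pow_smul_eq_zero_of_fg [IsNoetherianRing R] {N : Submodule R E} (hN : N.FG) :
    ∃ n, ∀ r ∈ maximalIdeal R ^ n, ∀ x ∈ N, r • x = 0 := by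
  induction N, hN using Submodule.fg_induction with
  | singleton x =>
    obtain ⟨n, hn⟩ := hE.exists_pow_smul_eq_zero x
    refine ⟨n, fun r hr y hy => ?_⟩
    obtain ⟨s, rfl⟩ := Submodule.mem_span_singleton.mp hy
    rw [smul_comm, hn r hr, smul_zero]
  | sup N₁ N₂ _ _ h₁ h₂ =>
    obtain ⟨n₁, h₁⟩ := h₁
    obtain ⟨n₂, h₂⟩ := h₂
    refine ⟨max n₁ n₂, fun r hr y hy => ?_⟩
    obtain ⟨a, ha, b, hb, rfl⟩ := Submodule.mem_sup.mp hy
    rw [smul_add, h₁ r (Ideal.pow_le_pow_right (le_max_left _ _) hr) a ha,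
      h₂ r (Ideal.pow_le_pow_right (le_max_right _ _) hr) b hb, add_zero]

/-- Matlis duality does not increase the length. -/
theorem length_hom_le {M : Type u} [AddCommGroup M] [Module R M] (hM : IsFiniteLength R M) :
    Module.length R (M →ₗ[R] E) ≤ Module.length R M := by
  obtain ⟨w, hw0, -, hw⟩ := hE.exists_socle_generator
  induction hM with
  | of_subsingleton =>
    rw [Module.length_eq_zero]
    exact bot_le
  | @of_simple_quotient M _ _ N hs _ ih =>
    have hsimple : Module.length R ((M ⧸ N) →ₗ[R] E) ≤ 1 := by
      obtain ⟨I, hI, ⟨e⟩⟩ := isSimpleModule_iff_quot_maximal.mp hs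
      have hIm : I = maximalIdeal R := eq_maximalIdeal hI
      have hwsimple : IsSimpleModule R (Submodule.span R {w}) := by
        rw [isSimpleModule_iff_isAtom]
        refine ⟨by rwa [Ne, Submodule.span_singleton_eq_bot], fun b hb => ?_⟩
        by_contra hb0
        exact hb.not_ge ((Submodule.span_singleton_le_iff_mem _ _).mpr (hw b hb0))
      set y : M ⧸ N := e.symm (Ideal.Quotient.mk I 1) with hy
      have hgen : ∀ z : M ⧸ N, ∃ r : R, z = r • y := by
        intro z
        obtain ⟨r, hr⟩ := Ideal.Quotient.mk_surjective (e z)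
        refine ⟨r, e.injective ?_⟩
        rw [map_smul, hy, LinearEquiv.apply_symm_apply, ← hr, Algebra.smul_def, map_one, mul_one]
        rfl
      let ev : ((M ⧸ N) →ₗ[R] E) →ₗ[R] Submodule.span R {w} :=
        LinearMap.codRestrict _ (LinearMap.applyₗ y) fun h => by
          refine mem_span_of_smul_eq_zero hw hw0 fun r hr => ?_
          rw [LinearMap.applyₗ_apply_apply, ← map_smul, hy, ← map_smul, Algebra.smul_def, map_one,
            mul_one]
          rw [show algebraMap R (R ⧸ I) r = 0 from
            Ideal.Quotient.eq_zero_iff_mem.mpr (hIm ▸ hr), map_zero, map_zero]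
      have hev : Function.Injective ev := by
        intro h₁ h₂ h
        ext z
        obtain ⟨r, hr⟩ := hgen (N.mkQ z)
        have h' : h₁ y = h₂ y := congrArg Subtype.val h
        rw [LinearMap.comp_apply, LinearMap.comp_apply, hr, map_smul, map_smul, h']
      exact (Module.length_le_of_injective ev hev).trans (Module.length_eq_one R _).le
    have hsub : Function.Injective (LinearMap.lcomp R E N.mkQ) := by
      intro h₁ h₂ h
      exact (LinearMap.cancel_right (Submodule.mkQ_surjective N)).mp h
    have hres : Function.Surjective (LinearMap.lcomp R E N.subtype) := by
      intro g
      obtain ⟨h, hh⟩ := hE.1.out N.subtype Subtype.val_injective g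
      exact ⟨h, LinearMap.ext hh⟩
    have hexact : Function.Exact (LinearMap.lcomp R E N.mkQ) (LinearMap.lcomp R E N.subtype) := by
      intro h
      constructor
      · intro h0
        have hker : N ≤ LinearMap.ker h := fun x hx => LinearMap.congr_fun h0 ⟨x, hx⟩
        exact ⟨N.liftQ h hker, N.liftQ_mkQ h hker⟩
      · rintro ⟨g, rfl⟩
        ext x
        change g (N.mkQ x) = 0
        rw [(N.mkQ_apply _).trans ((Submodule.Quotient.mk_eq_zero N).mpr x.2), map_zero]
    rw [Module.length_eq_add_of_exact _ _ hsub hres hexact,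
      Module.length_eq_add_of_exact N.subtype N.mkQ Subtype.val_injective
        (Submodule.mkQ_surjective N) (LinearMap.exact_subtype_mkQ N), add_comm,
      Module.length_eq_one R (M ⧸ N)]
    exact add_le_add ih hsimple

/-- On a finitely generated submodule `N`, Matlis duality gives
`length (R ⧸ Ann N) = length N = length (Hom(N, E))`, so the embedding of `R ⧸ Ann N` into
`Hom(N, E)` is surjective. -/
theorem exists_eq_smul_of_fg [IsNoetherianRing R] {N : Submodule R E} (hN : N.FG)
    (g : N →ₗ[R] E) : ∃ r : R, ∀ x : N, g x = r • (x : E) := by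
  have : Module.Finite R N := Module.Finite.iff_fg.mpr hN
  obtain ⟨n, hn⟩ := hE.exists_pow_smul_eq_zero_of_fg hN
  have hNfin : IsFiniteLength R N := isFiniteLength_of_pow_maximalIdeal_smul_eq_zero n
    fun r hr x => Subtype.ext (hn r hr x x.2)
  let I : Ideal R := N.annihilator
  have hI : ∀ r ∈ I, ∀ x : N, r • (x : E) = 0 :=
    fun r hr x => Submodule.mem_annihilator.mp hr x x.2
  let ψ : (R ⧸ I) →ₗ[R] (N →ₗ[R] E) :=
    Submodule.liftQ I (LinearMap.toSpanSingleton R _ N.subtype) fun r hr =>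
      LinearMap.ext fun x => hI r hr x
  have hψmk : ∀ r x, ψ (Ideal.Quotient.mk I r) x = r • (x : E) := fun r x => rfl
  have hψ : Function.Injective ψ := by
    rw [injective_iff_map_eq_zero]
    intro r hr
    obtain ⟨r, rfl⟩ := Ideal.Quotient.mk_surjective r
    rw [Ideal.Quotient.eq_zero_iff_mem]
    exact Submodule.mem_annihilator.mpr fun x hx => LinearMap.congr_fun hr ⟨x, hx⟩
  let θ : N →ₗ[R] ((R ⧸ I) →ₗ[R] E) :=
    { toFun := fun x => Submodule.liftQ I (LinearMap.toSpanSingleton R E x) fun r hr => hI r hr x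
      map_add' := fun x y => by
        ext
        change (1 : R) • ((x + y : N) : E) = (1 : R) • (x : E) + (1 : R) • (y : E)
        rw [← smul_add]
        rfl
      map_smul' := fun r x => by
        ext
        change (1 : R) • ((r • x : N) : E) = r • ((1 : R) • (x : E))
        rw [one_smul, one_smul]
        rfl }
  have hθ : Function.Injective θ := by
    intro x y hxy
    have : (1 : R) • (x : E) = (1 : R) • (y : E) :=
      LinearMap.congr_fun hxy (Ideal.Quotient.mk I 1)
    rw [one_smul, one_smul] at this
    exact Subtype.ext this
  have h1 : Module.length R (R ⧸ I) ≤ Module.length R (N →ₗ[R] E) :=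
    Module.length_le_of_injective ψ hψ
  have h2 := hE.length_hom_le hNfin
  have h3 : Module.length R N ≠ ⊤ := Module.length_ne_top_iff.mpr hNfin
  have hhom : IsFiniteLength R (N →ₗ[R] E) :=
    Module.length_ne_top_iff.mp (ne_top_of_le_ne_top h3 h2)
  have hquot : IsFiniteLength R (R ⧸ I) := hhom.of_injective hψ
  have h4 : Module.length R N ≤ Module.length R (R ⧸ I) :=
    (Module.length_le_of_injective θ hθ).trans (hE.length_hom_le hquot)
  obtain ⟨_, _⟩ := isFiniteLength_iff_isNoetherian_isArtinian.mp hhom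
  have hrange : LinearMap.range ψ = ⊤ := by
    by_contra hne
    have := Submodule.length_lt hne
    rw [← (LinearEquiv.ofInjective ψ hψ).length_eq] at this
    exact (this.trans_le (h2.trans h4)).ne rfl
  obtain ⟨r, hr⟩ := LinearMap.range_eq_top.mp hrange g
  obtain ⟨r, rfl⟩ := Ideal.Quotient.mk_surjective r
  exact ⟨r, fun x => by rw [← hr, hψmk]⟩

theorem fg_torsionBySet_pow [IsNoetherianRing R] (n : ℕ) :
    (Submodule.torsionBySet R E (maximalIdeal R ^ n : Ideal R)).FG := by
  set I := maximalIdeal R ^ n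
  set N := Submodule.torsionBySet R E I with hN
  have hquot : IsFiniteLength R (R ⧸ I) := isFiniteLength_of_pow_maximalIdeal_smul_eq_zero n
    fun r hr x => by
      obtain ⟨x, rfl⟩ := Ideal.Quotient.mk_surjective x
      exact Ideal.Quotient.eq_zero_iff_mem.mpr (I.mul_mem_right x hr)
  have hhom : IsFiniteLength R ((R ⧸ I) →ₗ[R] E) :=
    Module.length_ne_top_iff.mp (ne_top_of_le_ne_top (Module.length_ne_top_iff.mpr hquot)
      (hE.length_hom_le hquot))
  have hle : N ≤ LinearMap.range
      (LinearMap.applyₗ (R := R) (M := R ⧸ I) (M₂ := E) (Ideal.Quotient.mk I 1)) := by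
    intro x hx
    refine ⟨Submodule.liftQ I (LinearMap.toSpanSingleton R E x) fun r hr =>
      (Submodule.mem_torsionBySet_iff _ _).mp hx ⟨r, hr⟩, ?_⟩
    exact one_smul R x
  have := (isFiniteLength_iff_isNoetherian_isArtinian.mp hhom).1
  have := isNoetherian_of_le hle
  exact Module.Finite.iff_fg.mp inferInstance

theorem mem_pow_of_smul_torsionBySet_eq_zero {n : ℕ} {r : R}
    (h : ∀ x ∈ Submodule.torsionBySet R E (maximalIdeal R ^ n : Ideal R), r • x = 0) :
    r ∈ maximalIdeal R ^ n := by
  set I := maximalIdeal R ^ n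
  by_contra hr
  obtain ⟨g, hg⟩ := hE.exists_hom_ne_zero (M := R ⧸ I) (x := Ideal.Quotient.mk I r)
    (mt Ideal.Quotient.eq_zero_iff_mem.mp hr)
  have hsmul : ∀ s : R, g (Ideal.Quotient.mk I s) = s • g 1 := by
    intro s
    rw [← map_smul, Algebra.smul_def, mul_one]
    rfl
  refine hg ?_
  rw [hsmul]
  refine h _ ((Submodule.mem_torsionBySet_iff _ _).mpr fun s => ?_)
  rw [← hsmul, Ideal.Quotient.eq_zero_iff_mem.mpr s.2, map_zero]

/-- Over a complete local ring, every endomorphism of the injective hull of the residue field is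
the multiplication by an element of the ring. -/
theorem exists_eq_smul [IsNoetherianRing R] [IsAdicComplete (maximalIdeal R) R]
    (g : E →ₗ[R] E) : ∃ r : R, ∀ x, g x = r • x := by
  choose f hf using fun n => hE.exists_eq_smul_of_fg (hE.fg_torsionBySet_pow n)
    (g ∘ₗ Submodule.subtype _)
  have hf' : ∀ n, ∀ x ∈ Submodule.torsionBySet R E (maximalIdeal R ^ n : Ideal R),
      g x = f n • x := fun n x hx => hf n ⟨x, hx⟩
  obtain ⟨r, hr⟩ := IsPrecomplete.prec (I := maximalIdeal R) (M := R) inferInstance (f := f) (by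
    intro m n hmn
    rw [SModEq.sub_mem, smul_eq_mul, Ideal.mul_top]
    refine hE.mem_pow_of_smul_torsionBySet_eq_zero fun x hx => ?_
    have hx' := Submodule.torsionBySet_le_torsionBySet_of_subset (M := E)
      (SetLike.coe_subset_coe.mpr (Ideal.pow_le_pow_right (I := maximalIdeal R) hmn)) hx
    rw [sub_smul, ← hf' m x hx, ← hf' n x hx', sub_self])
  refine ⟨r, fun x => ?_⟩
  obtain ⟨n, hn⟩ := hE.exists_pow_smul_eq_zero x
  have h1 := hr n
  rw [SModEq.sub_mem, smul_eq_mul, Ideal.mul_top] at h1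
  have h2 := hn _ h1
  rw [sub_smul, sub_eq_zero] at h2
  rw [← h2]
  exact hf' n x ((Submodule.mem_torsionBySet_iff _ _).mpr fun s => hn s s.2)

/-- A submodule of the injective hull of the residue field of a complete local ring is determined
by its annihilator. -/
theorem le_of_annihilator_le [IsNoetherianRing R] [IsAdicComplete (maximalIdeal R) R]
    {N N' : Submodule R E} (h : N.annihilator ≤ N'.annihilator) : N' ≤ N := by
  intro x hx
  by_contra hxN
  obtain ⟨g, hg⟩ := hE.exists_hom_ne_zero (M := E ⧸ N) (x := N.mkQ x)
    (fun h0 => hxN ((Submodule.Quotient.mk_eq_zero N).mp h0))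
  obtain ⟨r, hr⟩ := hE.exists_eq_smul (g ∘ₗ N.mkQ)
  refine hg ?_
  rw [← LinearMap.comp_apply, hr]
  refine Submodule.mem_annihilator.mp (h (Submodule.mem_annihilator.mpr fun y hy => ?_)) x hx
  rw [← hr, LinearMap.comp_apply, (N.mkQ_apply y).trans ((Submodule.Quotient.mk_eq_zero N).mpr hy),
    map_zero]

end IsInjectiveHull

end Matlis

/-! ### The trace of a finite local homomorphism -/

section Trace

open IsLocalRing

/-- For a finite extension of fields, a nonzero linear form generates the dual space over the
larger field. -/
theorem exists_eq_form_mul {k K : Type*} [Field k] [Field K] (f : k →+* K) (hfin : f.Finite)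
    (T : K →+ k) (hT : ∀ a x, T (f a * x) = a * T x) (hT0 : ∃ x, T x ≠ 0)
    (h : K →+ k) (hh : ∀ a x, h (f a * x) = a * h x) : ∃ z, ∀ x, h x = T (x * z) := by
  obtain ⟨c, n, a, b, hc, H⟩ := exists_dualFrame f f.injective hfin T hT hT0
  refine ⟨c⁻¹ * ∑ i, f (h (b i)) * a i, fun x => ?_⟩
  have hx : x = c * (c⁻¹ * x) := (mul_inv_cancel_left₀ hc x).symm
  conv_lhs => rw [hx, H, map_sum]
  rw [← mul_assoc, Finset.mul_sum, map_sum]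
  refine Finset.sum_congr rfl fun i _ => ?_
  rw [hh, mul_comm, ← hT]
  congr 1
  ring

theorem exists_form_ne_zero {k K : Type*} [Field k] [Field K] (f : k →+* K) :
    ∃ T : K →+ k, (∀ a x, T (f a * x) = a * T x) ∧ ∃ x, T x ≠ 0 := by
  let := f.toAlgebra
  obtain ⟨T, hT⟩ : ∃ T : Module.Dual k K, T 1 ≠ 0 := by
    by_contra hcon
    push Not at hcon
    exact one_ne_zero ((Module.forall_dual_apply_eq_zero_iff k (1 : K)).mp hcon)
  exact ⟨T, fun a x => T.map_smul a x, 1, hT⟩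

/-- A nonzero element killed by a power of `I` has a nonzero multiple killed by `I`. -/
theorem exists_smul_ne_zero_of_pow_smul_eq_zero {S M : Type*} [CommRing S] [AddCommGroup M]
    [Module S M] (I : Ideal S) {n : ℕ} {x : M} (hx : x ≠ 0) (hn : ∀ s ∈ I ^ n, s • x = 0) :
    ∃ s : S, s • x ≠ 0 ∧ ∀ r ∈ I, r • s • x = 0 := by
  induction n with
  | zero => exact absurd (by simpa using hn 1 (by simp)) hx
  | succ n ih =>
    by_cases h : ∀ s ∈ I ^ n, s • x = 0
    · exact ih h
    · push Not at h
      obtain ⟨s, hs, hsx⟩ := h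
      refine ⟨s, hsx, fun r hr => ?_⟩
      rw [smul_smul]
      exact hn _ (by rw [pow_succ']; exact Ideal.mul_mem_mul hr hs)

/-- The `S`-module structure on `Hom_R(S, E)` given by `(s • h) x = h (x * s)`. -/
abbrev coextendedModule (R S E : Type*) [CommRing R] [CommRing S] [Algebra R S] [AddCommGroup E]
    [Module R E] : Module S (S →ₗ[R] E) where
  smul s h := h ∘ₗ LinearMap.mulRight R s
  one_smul h := LinearMap.ext fun x => congrArg h (mul_one x)
  mul_smul a b h := LinearMap.ext fun x => congrArg h (by
    change x * (a * b) = x * a * b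
    ring)
  smul_zero a := rfl
  smul_add a h h' := rfl
  add_smul a b h := LinearMap.ext fun x => by
    change h (x * (a + b)) = h (x * a) + h (x * b)
    rw [mul_add, map_add]
  zero_smul h := LinearMap.ext fun x => by
    change h (x * 0) = 0
    rw [mul_zero, map_zero]

variable {R S E E' : Type u} [CommRing R] [IsLocalRing R] [IsNoetherianRing R] [CommRing S]
  [IsLocalRing S] [IsNoetherianRing S] [AddCommGroup E] [Module R E] [AddCommGroup E'] [Module S E']

/-- For a finite local homomorphism `f : R → S`, the module `Hom_R(S, E)` is an injective hull over
`S` of the residue field of `S`. In other words there is an `R`-linear form `t : E' → E` such that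
every `R`-linear map `S → E` is `s ↦ t (s • z)` for a unique `z : E'`. The `R`-linearity is stated
through `f`, so that `S` may be `R` itself and `f` a Frobenius. -/
theorem IsInjectiveHull.exists_trace (hE : IsInjectiveHull R (ResidueField R) E)
    (hE' : IsInjectiveHull S (ResidueField S) E') (f : R →+* S) [IsLocalHom f] (hfin : f.Finite)
    (hrad : maximalIdeal S ≤ ((maximalIdeal R).map f).radical) :
    ∃ t : E' →+ E, (∀ (r : R) (z : E'), t (f r • z) = r • t z) ∧
      ∀ h : S →+ E, (∀ (r : R) (s : S), h (f r * s) = r • h s) →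
        ∃! z : E', ∀ s, h s = t (s • z) := by
  let := f.toAlgebra
  have : Module.Finite R S := hfin
  let : Module R E' := Module.compHom E' f
  obtain ⟨ι, hι, hsoc⟩ := hE.exists_residueField_embedding
  obtain ⟨ι', hι', hsoc'⟩ := hE'.exists_residueField_embedding
  have hιr : ∀ (r : R) (a : ResidueField R), ι (residue R r * a) = r • ι a :=
    fun r a => ι.map_smul r a
  have hιr' : ∀ (s : S) (a : ResidueField S), ι' (residue S s * a) = s • ι' a :=
    fun s a => ι'.map_smul s a
  -- extend a nonzero form on the socles
  set f' : ResidueField R →+* ResidueField S := ResidueField.map f with hf'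
  have hf'r : ∀ r, f' (residue R r) = residue S (f r) := fun r => ResidueField.map_residue f r
  have hfin' : f'.Finite := by
    refine RingHom.Finite.of_comp_finite (f := residue R) ?_
    rw [hf', ResidueField.map_comp_residue]
    exact (RingHom.Finite.of_surjective _ residue_surjective).comp hfin
  obtain ⟨T, hT, hT0⟩ := exists_form_ne_zero f'
  let ιR : ResidueField S →ₗ[R] E' :=
    { toFun := ι', map_add' := ι'.map_add, map_smul' := fun r a => hιr' (f r) a }
  let g : ResidueField S →ₗ[R] E :=
    { toFun := fun a => ι (T a)
      map_add' := fun a b => by rw [map_add, map_add]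
      map_smul' := fun r a => by
        rw [RingHom.id_apply, ← hιr, ← hT, hf'r]
        rfl }
  obtain ⟨t, ht⟩ := hE.1.out ιR hι' g
  have ht' : ∀ a, t (ι' a) = ι (T a) := ht
  have htr : ∀ (r : R) (z : E'), t (f r • z) = r • t z := fun r z => t.map_smul r z
  let : Module S (S →ₗ[R] E) := coextendedModule R S E
  have hsmul : ∀ (s x : S) (h : S →ₗ[R] E), (s • h) x = h (x * s) := fun _ _ _ => rfl
  let Φ : E' →ₗ[S] (S →ₗ[R] E) :=
    { toFun := fun z =>
        { toFun := fun s => t (s • z)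
          map_add' := fun a b => by rw [add_smul, map_add]
          map_smul' := fun r s => by
            rw [RingHom.id_apply, ← htr, smul_smul]
            rfl }
      map_add' := fun a b => LinearMap.ext fun s => by
        change t (s • (a + b)) = t (s • a) + t (s • b)
        rw [smul_add, map_add]
      map_smul' := fun r z => LinearMap.ext fun s => by
        change t (s • r • z) = t ((s * r) • z)
        rw [smul_smul] }
  have hΦ : ∀ z s, Φ z s = t (s • z) := fun _ _ => rfl
  have hΦinj : Function.Injective Φ := by
    rw [← LinearMap.ker_eq_bot]
    by_contra hne
    have h1 := LinearMap.mem_ker.mp (hsoc' _ hne)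
    obtain ⟨x, hx⟩ := hT0
    obtain ⟨s, rfl⟩ := residue_surjective x
    have h2 := LinearMap.congr_fun h1 s
    rw [hΦ, ← hιr', ht', mul_one, LinearMap.zero_apply] at h2
    exact hx ((map_eq_zero_iff _ hι).mp h2)
  -- `Φ` splits since `E'` is injective, and it is an essential extension
  obtain ⟨ρ, hρ⟩ := hE'.1.out Φ hΦinj LinearMap.id
  have hρker : ∀ h, ρ h = 0 → h = 0 := by
    intro h hρh
    by_contra hh0
    obtain ⟨n, hn⟩ : ∃ n, ∀ s ∈ maximalIdeal S ^ n, s • h = 0 := by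
      have hfg : (LinearMap.range h).FG := by
        rw [LinearMap.range_eq_map]
        exact Submodule.FG.map _ Module.Finite.fg_top
      obtain ⟨n, hn⟩ := hE.exists_pow_smul_eq_zero_of_fg hfg
      obtain ⟨m, hm⟩ := Ideal.exists_pow_le_of_le_radical_of_fg hrad
        (IsNoetherian.noetherian (maximalIdeal S))
      refine ⟨m * n, fun s hs => LinearMap.ext fun x => ?_⟩
      rw [hsmul, LinearMap.zero_apply]
      rw [pow_mul] at hs
      have hs' := Ideal.pow_right_mono hm n hs
      rw [← Ideal.map_pow] at hs'
      clear hs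
      induction hs' using Submodule.span_induction generalizing x with
      | mem y hy =>
        obtain ⟨r, hr, rfl⟩ := hy
        rw [mul_comm]
        exact (h.map_smul r x).trans (hn r hr _ ⟨x, rfl⟩)
      | zero => rw [mul_zero, map_zero]
      | add a b _ _ ha hb => rw [mul_add, map_add, ha, hb, add_zero]
      | smul a b _ hb => rw [smul_eq_mul, ← mul_assoc, hb]
    -- a nonzero multiple of `h` in the socle comes from a form on the residue fields, hence from `Φ`
    obtain ⟨s₀, hs₀, hkill⟩ := exists_smul_ne_zero_of_pow_smul_eq_zero _ hh0 hn
    set h' := s₀ • h with hh'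
    have hkill' : ∀ r ∈ maximalIdeal S, h' r = 0 := fun r hr => by
      have := LinearMap.congr_fun (hkill r hr) 1
      rwa [hsmul, one_mul] at this
    have hh'lin : ∀ (r : R) (s : S), h' (f r * s) = r • h' s := fun r s => h'.map_smul r s
    have hmem : ∀ s, ∃ a, ι a = h' s := by
      intro s
      have hspan : h' s ∈ Submodule.span R {ι 1} := by
        refine mem_span_of_smul_eq_zero hsoc ((map_ne_zero_iff _ hι).mpr one_ne_zero)
          fun r hr => ?_
        rw [← hh'lin]
        exact hkill' _ (Ideal.mul_mem_right _ _ (map_nonunit f r hr))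
      obtain ⟨r, hr⟩ := Submodule.mem_span_singleton.mp hspan
      exact ⟨residue R r * 1, by rw [hιr, hr]⟩
    have hdesc : ∀ x : ResidueField S, ∃ a, ∀ s, residue S s = x → ι a = h' s := by
      intro x
      obtain ⟨s, rfl⟩ := residue_surjective x
      obtain ⟨a, ha⟩ := hmem s
      refine ⟨a, fun s' hs' => ?_⟩
      rw [ha, ← sub_eq_zero, ← map_sub]
      refine hkill' _ ?_
      rw [← residue_eq_zero_iff, map_sub, hs', sub_self]
    choose G hG using hdesc
    have hG' : ∀ s, ι (G (residue S s)) = h' s := fun s => hG _ s rfl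
    obtain ⟨z, hz⟩ := exists_eq_form_mul f' hfin' T hT hT0
      (AddMonoidHom.mk' G fun x y => by
        obtain ⟨s, rfl⟩ := residue_surjective x
        obtain ⟨s', rfl⟩ := residue_surjective y
        apply hι
        rw [← map_add (residue S), hG', map_add, map_add, hG', hG'])
      (fun a x => by
        obtain ⟨r, rfl⟩ := residue_surjective a
        obtain ⟨s, rfl⟩ := residue_surjective x
        apply hι
        change ι (G (f' (residue R r) * residue S s)) = ι (residue R r * G (residue S s))
        rw [hf'r, ← map_mul, hιr, hG', hG', hh'lin])
    have heq : h' = Φ (ι' z) := LinearMap.ext fun s => by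
      rw [hΦ, ← hιr', ht', ← hz, AddMonoidHom.mk'_apply, hG']
    have h0 : ι' z = 0 := by
      have h1 : ρ (Φ (ι' z)) = ι' z := hρ _
      rw [← h1, ← heq, hh', map_smul, hρh, smul_zero]
    exact hs₀ (by rw [heq, h0, map_zero])
  refine ⟨t.toAddMonoidHom, htr, fun h hlin => ?_⟩
  let hl : S →ₗ[R] E := { h with map_smul' := hlin }
  have hl_eq : hl = Φ (ρ hl) := by
    rw [← sub_eq_zero]
    refine hρker _ ?_
    have h1 : ρ (Φ (ρ hl)) = ρ hl := hρ _
    rw [map_sub, h1, sub_self]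
  refine ⟨ρ hl, fun s => LinearMap.congr_fun hl_eq s, fun z hz => ?_⟩
  apply hΦinj
  rw [← hl_eq]
  exact LinearMap.ext fun s => (hz s).symm

end Trace

/-! ### The `R[F]`-module structure dual to a splitting -/

section Dual

open IsLocalRing

variable {R E : Type u} [CommRing R] [IsLocalRing R] [IsNoetherianRing R] [AddCommGroup E]
  [Module R E]

/-- The Matlis dual of a Cartier linear map `C : F_* R → R`, through the identification of
`Hom_R(F_* R, E)` with `F_* E` given by a trace map `t`. -/
theorem IsInjectiveHull.exists_semilinear_dual (hE : IsInjectiveHull R (ResidueField R) E) {Q : ℕ}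
    (hQ : Q ≠ 0) (F : R →+* R) (hF : ∀ r, F r = r ^ Q) (hfin : F.Finite) {C : R →+ R}
    (hC : IsCartierLinear R Q C) :
    ∃ (t : E →+ E) (φ : E →ₛₗ[F] E), ∀ s z, t (s • φ z) = C s • z := by
  have : IsLocalHom F := ⟨fun r hr => by rwa [hF, isUnit_pow_iff hQ] at hr⟩
  have hrad : maximalIdeal R ≤ ((maximalIdeal R).map F).radical := fun r hr =>
    ⟨Q, by rw [← hF]; exact Ideal.mem_map_of_mem F hr⟩
  obtain ⟨t, ht, H⟩ := hE.exists_trace hE F hfin hrad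
  have hex : ∀ z : E, ∃! y : E, ∀ s, C s • z = t (s • y) := fun z =>
    H ((LinearMap.toSpanSingleton R E z).toAddMonoidHom.comp C) fun r s => by
      have : C (F r * s) = r * C s := by rw [hF]; exact hC r s
      simp only [AddMonoidHom.comp_apply, LinearMap.toAddMonoidHom_coe,
        LinearMap.toSpanSingleton_apply, this, mul_smul]
  choose φ hφ huniq using fun z => (hex z)
  refine ⟨t, ⟨⟨φ, fun a b => ?_⟩, fun r z => ?_⟩, fun s z => (hφ z s).symm⟩
  · refine (huniq (a + b) _ fun s => ?_).symm
    rw [smul_add, smul_add, map_add, hφ a s, hφ b s]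
  · refine (huniq (r • z) _ fun s => ?_).symm
    change C s • r • z = t (s • F r • φ z)
    rw [smul_comm s (F r), ht, ← hφ z s, smul_comm]

variable {p k : ℕ} [Fact p.Prime] [CharP R p]

/-- The semilinear map on the injective hull dual to a splitting `C` is anti-nilpotent, and its
stable submodules embed, by taking annihilators, into the finite set of `C`-stable ideals. -/
theorem IsInjectiveHull.exists_antiNilpotent_of_splitting [IsAdicComplete (maximalIdeal R) R]
    (hE : IsInjectiveHull R (ResidueField R) E) (hk : 0 < k)
    (hfin : (iterateFrobenius R p k).Finite) {C : R →+ R}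
    (hC : IsFrobeniusSplitting (p ^ k) C) :
    ∃ φ : E →ₛₗ[iterateFrobenius R p k] E,
      IsAntiNilpotent φ ∧ {N : Submodule R E | IsFSubmodule φ N}.Finite := by
  have hp : p.Prime := Fact.out
  have hQ : 2 ≤ p ^ k := hp.two_le.trans (Nat.le_self_pow hk.ne' p)
  have hF : ∀ r, iterateFrobenius R p k r = r ^ p ^ k := fun r => iterateFrobenius_def p k r
  obtain ⟨t, φ, h⟩ := hE.exists_semilinear_dual (by omega) _ hF hfin hC.1
  refine ⟨φ, ?_, ?_⟩
  · intro N N' _ _ hle ⟨n, hn⟩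
    refine le_antisymm hle (hE.le_of_annihilator_le fun s hs => ?_)
    have hiter : ∀ n s z, t^[n] (s • φ^[n] z) = C^[n] s • z := by
      intro n
      induction n with
      | zero => exact fun s z => rfl
      | succ n ih =>
        intro s z
        rw [Function.iterate_succ_apply, Function.iterate_succ_apply', h, ih,
          Function.iterate_succ_apply]
    -- `s = C ^ n (s ^ (Q ^ n))`, and `s ^ (Q ^ n)` kills `φ ^ n (N')`
    have hsplit : ∀ n s, C^[n] (s ^ (p ^ k) ^ n) = s := by
      intro n
      induction n with
      | zero => intro s; simp
      | succ n ih =>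
        intro s
        rw [Function.iterate_succ_apply, pow_succ, pow_mul, hC.2, ih]
    refine Submodule.mem_annihilator.mpr fun z hz => ?_
    rw [← hsplit n s, ← hiter]
    have hmem : s ^ (p ^ k) ^ n ∈ N.annihilator :=
      Ideal.pow_mem_of_mem _ hs _ (by positivity)
    rw [Submodule.mem_annihilator.mp hmem _ (hn z hz)]
    exact Function.iterate_fixed (map_zero t) n
  · refine ((finite_cartierSubmodule hQ _ hF hfin hC).preimage
      (f := fun N : Submodule R E => N.annihilator) ?_).subset ?_
    · intro N _ N' _ hNN'
      exact le_antisymm (hE.le_of_annihilator_le hNN'.ge) (hE.le_of_annihilator_le hNN'.le)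
    · intro N hN s hs
      refine Submodule.mem_annihilator.mpr fun z hz => ?_
      rw [← h, Submodule.mem_annihilator.mp hs _ (hN z hz), map_zero]

end Dual

/-! ### Iterates of the Frobenius -/

section Iterates

variable {R : Type*} [CommRing R] {p : ℕ} [Fact p.Prime] [CharP R p]

theorem iterateFrobenius_mul_finite {k : ℕ} (h : (iterateFrobenius R p k).Finite) (e : ℕ) :
    (iterateFrobenius R p (k * e)).Finite := by
  induction e with
  | zero =>
    have : iterateFrobenius R p (k * 0) = RingHom.id R := by
      ext r
      rw [iterateFrobenius_def, mul_zero, pow_zero, pow_one, RingHom.id_apply]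
    rw [this]
    exact RingHom.Finite.id R
  | succ e ih =>
    have : iterateFrobenius R p (k * (e + 1)) =
        (iterateFrobenius R p k).comp (iterateFrobenius R p (k * e)) := by
      ext r
      rw [RingHom.comp_apply, iterateFrobenius_def, iterateFrobenius_def, iterateFrobenius_def,
        ← pow_mul, ← pow_add, mul_add, mul_one]
    rw [this]
    exact h.comp ih

/-- A splitting of an iterate of the Frobenius restricts to a splitting of the Frobenius. -/
theorem IsFrobeniusSplitting.exists_of_iterate {k e : ℕ} (he : 0 < e) {C : R →+ R}
    (hC : IsFrobeniusSplitting (p ^ (k * e)) C) :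
    ∃ C' : R →+ R, IsFrobeniusSplitting (p ^ k) C' := by
  obtain ⟨m, rfl⟩ := Nat.exists_eq_succ_of_ne_zero he.ne'
  have hpow : ∀ r : R, (r ^ p ^ k) ^ p ^ (k * m) = r ^ p ^ (k * (m + 1)) := fun r => by
    rw [← pow_mul, ← pow_add, mul_add, mul_one, add_comm]
  refine ⟨C.comp (iterateFrobenius R p (k * m)).toAddMonoidHom, fun r s => ?_, fun r => ?_⟩
  · change C (iterateFrobenius R p (k * m) (r ^ p ^ k * s)) =
      r * C (iterateFrobenius R p (k * m) s)
    rw [iterateFrobenius_def, iterateFrobenius_def, mul_pow, hpow]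
    exact hC.1 r _
  · change C (iterateFrobenius R p (k * m) (r ^ p ^ k)) = r
    rw [iterateFrobenius_def, hpow]
    exact hC.2 r

end Iterates

/-! ### The universal property of the Frobenius action on top local cohomology -/

section UniversalProperty

variable {R : Type u} [CommRing R] {p k : ℕ} [Fact p.Prime] [CharP R p]

/-- Elements of `R_y` have the form `a / y ^ (Q * n)` for all large `n`, so finitely many of them
have a common denominator of this form. -/
theorem exists_eq_smul_invSelf_pow (y : R) (z : Localization.Away y) (Q : ℕ) (hQ : 0 < Q) :
    ∃ (n₀ : ℕ), ∀ n, n₀ ≤ n → ∃ a : R,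
      z = a • (IsLocalization.Away.invSelf y : Localization.Away y) ^ (Q * n) := by
  obtain ⟨n₀, a, ha⟩ := IsLocalization.Away.surj y z
  refine ⟨n₀, fun n hn => ⟨a * y ^ (Q * n - n₀), ?_⟩⟩
  have hle : n₀ ≤ Q * n := hn.trans (Nat.le_mul_of_pos_left n hQ)
  have hinv : algebraMap R (Localization.Away y) y * IsLocalization.Away.invSelf y = 1 :=
    IsLocalization.Away.mul_invSelf y
  rw [Algebra.smul_def, map_mul, ← ha, map_pow, mul_assoc z, ← pow_add, Nat.add_sub_cancel' hle,
    mul_assoc, ← mul_pow, hinv, one_pow, mul_one]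

variable {M : Type*} [AddCommGroup M] [Module R M]

/-- The Frobenius of `R_y` is universal among Frobenius-semilinear maps out of `R_y`: it exhibits
`R_y` as its own base change along the Frobenius of `R`. -/
theorem exists_linearMap_comp_algebraFrobenius (y : R)
    (ψ : Localization.Away y →ₛₗ[iterateFrobenius R p k] M) :
    ∃ g : Localization.Away y →ₗ[R] M,
      (∀ z, g (algebraFrobenius (R := R) p k (Localization.Away y) z) = ψ z) ∧
      ∀ (a : R) (n : ℕ),
        g (a • (IsLocalization.Away.invSelf y : Localization.Away y) ^ (p ^ k * n)) =
          a • ψ ((IsLocalization.Away.invSelf y) ^ n) := by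
  have hp : p.Prime := Fact.out
  set Q := p ^ k with hQ
  have hQ0 : 0 < Q := Nat.pow_pos hp.pos
  set v : Localization.Away y := IsLocalization.Away.invSelf y with hv
  have hinv : ∀ n, algebraMap R (Localization.Away y) y ^ n * v ^ n = 1 := fun n => by
    rw [← mul_pow, hv, IsLocalization.Away.mul_invSelf, one_pow]
  have hψ : ∀ n m, ψ (v ^ n) = y ^ (Q * m) • ψ (v ^ (n + m)) := by
    intro n m
    have h1 : v ^ n = y ^ m • v ^ (n + m) := by
      rw [Algebra.smul_def, map_pow, pow_add, mul_left_comm, hinv, mul_one]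
    conv_lhs => rw [h1, map_smulₛₗ, iterateFrobenius_def, ← pow_mul, mul_comm m]
  have hzero : ∀ (c : R) (j n : ℕ), c • v ^ j = 0 → c • ψ (v ^ n) = 0 := by
    intro c j n hc
    have h1 : algebraMap R (Localization.Away y) c = 0 := by
      have := congrArg (· * algebraMap R (Localization.Away y) y ^ j) hc
      simp only [zero_mul] at this
      rwa [Algebra.smul_def, mul_assoc, mul_comm (v ^ j), hinv, mul_one] at this
    obtain ⟨⟨_, N, rfl⟩, hN⟩ := (IsLocalization.map_eq_zero_iff (Submonoid.powers y)
      (Localization.Away y) c).mp h1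
    simp only at hN
    have h2 : c * y ^ (Q * N) = 0 := by
      have : Q * N = N + (Q * N - N) :=
        (Nat.add_sub_cancel' (Nat.le_mul_of_pos_left N hQ0)).symm
      rw [this, pow_add, ← mul_assoc, mul_comm c, hN, zero_mul]
    rw [hψ n N, smul_smul, h2, zero_smul]
  -- `a / y ^ (Q * n) ↦ a • ψ (1 / y ^ n)` is well defined
  have hwd : ∀ (a b : R) (n m : ℕ), a • v ^ (Q * n) = b • v ^ (Q * m) →
      a • ψ (v ^ n) = b • ψ (v ^ m) := by
    intro a b n m hab
    have hshift : ∀ (a : R) (n m : ℕ),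
        (a * y ^ (Q * m)) • v ^ (Q * (n + m)) = a • v ^ (Q * n) := by
      intro a n m
      rw [Algebra.smul_def, Algebra.smul_def, map_mul, map_pow, mul_add, pow_add, mul_assoc,
        mul_left_comm (_ ^ (Q * m)), hinv, mul_one]
    rw [hψ n m, hψ m n, smul_smul, smul_smul, add_comm m n, ← sub_eq_zero, ← sub_smul]
    refine hzero _ (Q * (n + m)) _ ?_
    rw [sub_smul, hshift, add_comm n m, hshift, hab, sub_self]
  have hrep : ∀ z, ∃ w, ∀ (a : R) n, z = a • v ^ (Q * n) → w = a • ψ (v ^ n) := by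
    intro z
    obtain ⟨n₀, h⟩ := exists_eq_smul_invSelf_pow y z Q hQ0
    obtain ⟨a, ha⟩ := h n₀ le_rfl
    exact ⟨a • ψ (v ^ n₀), fun b m hb => hwd _ _ _ _ (ha.symm.trans hb)⟩
  choose g hg using hrep
  refine ⟨⟨⟨g, fun z z' => ?_⟩, fun r z => ?_⟩, fun z => ?_, fun a n => hg _ a n rfl⟩
  · obtain ⟨n, h⟩ := exists_eq_smul_invSelf_pow y z Q hQ0
    obtain ⟨n', h'⟩ := exists_eq_smul_invSelf_pow y z' Q hQ0
    obtain ⟨a, ha⟩ := h (max n n') (le_max_left _ _)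
    obtain ⟨b, hb⟩ := h' (max n n') (le_max_right _ _)
    rw [hg z a _ ha, hg z' b _ hb, ← add_smul]
    refine hg _ _ _ ?_
    exact (congrArg₂ (· + ·) ha hb).trans (add_smul _ _ _).symm
  · obtain ⟨n, h⟩ := exists_eq_smul_invSelf_pow y z Q hQ0
    obtain ⟨a, ha⟩ := h n le_rfl
    change g (r • z) = r • g z
    rw [hg z a n ha, smul_smul]
    refine hg _ _ _ ?_
    exact (congrArg (r • ·) ha).trans (mul_smul _ _ _).symm
  · obtain ⟨n, h⟩ := exists_eq_smul_invSelf_pow y z 1 one_pos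
    obtain ⟨a, ha⟩ := h n le_rfl
    rw [one_mul] at ha
    change g (z ^ Q) = ψ z
    rw [hg (z ^ Q) (a ^ Q) n, ha, map_smulₛₗ, iterateFrobenius_def]
    rw [ha, smul_pow, ← pow_mul, mul_comm]

theorem awayMap_invSelf {f g h : R} (hfg : f * h = g) (hd : h ∣ g) :
    awayMap hd (IsLocalization.Away.invSelf h) =
      f • (IsLocalization.Away.invSelf g : Localization.Away g) := by
  have h1 : awayMap hd (IsLocalization.Away.invSelf h) * algebraMap R _ h = 1 := by
    rw [← AlgHom.commutes (awayMap hd) h, ← map_mul, mul_comm, IsLocalization.Away.mul_invSelf,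
      map_one]
  have h2 : algebraMap R _ h * (f • (IsLocalization.Away.invSelf g : Localization.Away g)) = 1 := by
    rw [Algebra.smul_def, ← mul_assoc, ← map_mul, mul_comm h, hfg,
      IsLocalization.Away.mul_invSelf]
  exact left_inv_eq_right_inv h1 h2

variable {d : ℕ} (x : Fin d → R)

theorem awayMap_mem_range_cechTopDifferential (i : Fin d)
    (w : Localization.Away (∏ j ∈ Finset.univ.erase i, x j)) :
    awayMap (Finset.prod_dvd_prod_of_subset _ _ x (Finset.erase_subset i Finset.univ)) w ∈
      LinearMap.range (cechTopDifferential x) := by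
  refine ⟨Pi.single i ((-1 : R) ^ (i : ℕ) • w), ?_⟩
  rw [cechTopDifferential, LinearMap.sum_apply, Finset.sum_eq_single i]
  · simp only [LinearMap.smul_apply, LinearMap.comp_apply, LinearMap.proj_apply, Pi.single_eq_same,
      AlgHom.toLinearMap_apply, map_smul, smul_smul, ← mul_pow, neg_mul_neg, one_mul, one_pow,
      one_smul]
  · intro j _ hj
    simp only [LinearMap.smul_apply, LinearMap.comp_apply, LinearMap.proj_apply,
      Pi.single_eq_of_ne hj, map_zero, smul_zero]
  · exact fun h => absurd (Finset.mem_univ i) h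

/-- The natural Frobenius action on top local cohomology is universal: every Frobenius-semilinear
map factors through it. -/
theorem exists_linearMap_comp_frobeniusTopLocalCohomology
    (φ : TopLocalCohomology x →ₛₗ[iterateFrobenius R p k] M) :
    ∃ g : TopLocalCohomology x →ₗ[R] M,
      ∀ z, g (frobeniusTopLocalCohomology x p k z) = φ z := by
  have hQ0 : 0 < p ^ k := Nat.pow_pos (Fact.out : p.Prime).pos
  set N := LinearMap.range (cechTopDifferential x) with hN
  obtain ⟨g, hg, hginv⟩ := exists_linearMap_comp_algebraFrobenius (∏ j, x j) (φ.comp N.mkQ)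
  have hker : N ≤ LinearMap.ker g := by
    rintro _ ⟨w, rfl⟩
    rw [LinearMap.mem_ker, cechTopDifferential, LinearMap.sum_apply, map_sum]
    refine Finset.sum_eq_zero fun i _ => ?_
    rw [LinearMap.smul_apply, map_smul, LinearMap.comp_apply, LinearMap.proj_apply,
      AlgHom.toLinearMap_apply]
    have hd := Finset.prod_dvd_prod_of_subset _ _ x (Finset.erase_subset i Finset.univ)
    obtain ⟨n, h⟩ := exists_eq_smul_invSelf_pow _ (w i) (p ^ k) hQ0
    obtain ⟨b, hb⟩ := h n le_rfl
    -- `1 / ∏_{j ≠ i} x j = x i / ∏ j, x j`, whose powers have trivial cohomology class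
    have hinv := awayMap_invSelf (Finset.mul_prod_erase Finset.univ x (Finset.mem_univ i)) hd
    have hzero : φ (N.mkQ (awayMap hd
        (IsLocalization.Away.invSelf (∏ j ∈ Finset.univ.erase i, x j) ^ n))) = 0 := by
      rw [(N.mkQ_apply _).trans ((Submodule.Quotient.mk_eq_zero N).mpr
        (awayMap_mem_range_cechTopDifferential x i _)), map_zero]
    rw [map_pow, hinv, smul_pow, map_smul, map_smulₛₗ, iterateFrobenius_def, ← pow_mul] at hzero
    rw [hb, map_smul, map_pow, hinv, smul_pow, map_smul, hginv, mul_comm (p ^ k) n,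
      LinearMap.comp_apply, hzero, smul_zero, smul_zero]
  refine ⟨N.liftQ g hker, fun z => ?_⟩
  obtain ⟨z, rfl⟩ := N.mkQ_surjective z
  exact hg z

end UniversalProperty

/-! ### Multiples of a semilinear map -/

section AntiNilpotent

variable {R E : Type*} [CommRing R] [AddCommGroup E] [Module R E] {p k : ℕ} [ExpChar R p]
  {f φ : E →ₛₗ[iterateFrobenius R p k] E} {u : R}

theorem IsFSubmodule.of_eq_smul (h : ∀ z, φ z = u • f z) {N : Submodule R E}
    (hN : IsFSubmodule f N) : IsFSubmodule φ N := fun z hz => by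
  rw [h]
  exact N.smul_mem u (hN z hz)

theorem IsAntiNilpotent.of_eq_smul (h : ∀ z, φ z = u • f z) (hφ : IsAntiNilpotent φ) :
    IsAntiNilpotent f := by
  intro N N' hN hN' hle ⟨n, hn⟩
  refine hφ N N' (hN.of_eq_smul h) (hN'.of_eq_smul h) hle ⟨n, fun m hm => ?_⟩
  have key : ∀ n, ∃ c : R, φ^[n] m = c • f^[n] m := by
    intro n
    induction n with
    | zero => exact ⟨1, (one_smul R m).symm⟩
    | succ n ih =>
      obtain ⟨c, hc⟩ := ih
      refine ⟨u * iterateFrobenius R p k c, ?_⟩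
      rw [Function.iterate_succ_apply', Function.iterate_succ_apply', hc, h, map_smulₛₗ, mul_smul]
  obtain ⟨c, hc⟩ := key n
  rw [hc]
  exact N.smul_mem c (hn m hm)

end AntiNilpotent

end CartierPaper

theorem proposition5p6 {R : Type u} [CommRing R] [IsNoetherianRing R]
    (p : ℕ) [Fact p.Prime] [CharP R p] (k : ℕ) (hk : 0 < k)
    (hF : (iterateFrobenius R p k).Finite) :
    -- every splitting `C` of a power of Frobenius: finitely many Cartier submodules
    (∀ e : ℕ, 0 < e → ∀ C : R →+ R, CartierPaper.IsFrobeniusSplitting (p ^ (k * e)) C →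
      {I : Submodule R R | CartierPaper.IsCartierSubmodule C I}.Finite) ∧
    -- the complete local case
    ((∃ e : ℕ, 0 < e ∧ ∃ C : R →+ R, CartierPaper.IsFrobeniusSplitting (p ^ (k * e)) C) →
      ∀ [IsLocalRing R] [IsAdicComplete (IsLocalRing.maximalIdeal R) R],
        -- every injective hull `E` of the residue field
        (∀ (E : Type u) [AddCommGroup E] [Module R E],
          CartierPaper.IsInjectiveHull R (IsLocalRing.ResidueField R) E →
          ∃ φ : E →ₛₗ[iterateFrobenius R p k] E,
            CartierPaper.IsAntiNilpotent φ ∧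
            {N : Submodule R E | CartierPaper.IsFSubmodule φ N}.Finite) ∧
        -- the quasi-Gorenstein case: `H^d_𝔪(R)` is an injective hull of the residue field
        (∀ (d : ℕ) (x : Fin d → R), CartierPaper.IsSystemOfParameters x →
          CartierPaper.IsInjectiveHull R (IsLocalRing.ResidueField R)
            (CartierPaper.TopLocalCohomology x) →
          CartierPaper.IsAntiNilpotent (CartierPaper.frobeniusTopLocalCohomology x p k) ∧
          {N : Submodule R (CartierPaper.TopLocalCohomology x) |
            CartierPaper.IsFSubmodule
              (CartierPaper.frobeniusTopLocalCohomology x p k) N}.Finite)) := by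
  refine ⟨fun e he C hC => ?_, fun ⟨e, he, C, hC⟩ _ _ => ?_⟩
  · have hQ : 2 ≤ p ^ (k * e) := (Fact.out : p.Prime).two_le.trans
      (Nat.le_self_pow (Nat.mul_pos hk he).ne' p)
    exact CartierPaper.finite_cartierSubmodule hQ _ (fun r => iterateFrobenius_def p (k * e) r)
      (CartierPaper.iterateFrobenius_mul_finite hF e) hC
  · obtain ⟨C', hC'⟩ := hC.exists_of_iterate he
    refine ⟨fun E _ _ hE => hE.exists_antiNilpotent_of_splitting hk hF hC', fun d x _ hH => ?_⟩
    obtain ⟨φ, hanti, hfin⟩ := hH.exists_antiNilpotent_of_splitting hk hF hC'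
    obtain ⟨g, hg⟩ := CartierPaper.exists_linearMap_comp_frobeniusTopLocalCohomology x φ
    obtain ⟨u, hu⟩ := hH.exists_eq_smul g
    have h : ∀ z, φ z = u • CartierPaper.frobeniusTopLocalCohomology x p k z := fun z => by
      rw [← hg, hu]
    exact ⟨hanti.of_eq_smul h, hfin.subset fun N hN => hN.of_eq_smul h⟩
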